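/- Let $\mathcal B$ be a Krull–Schmidt exact category (in the sense of Quillen) with enough projectives and enough injectives. A cotorsion pair on $\mathcal B$ is a pair $(\mathcal U,\mathcal V)$ of full additive subcategories closed under direct summands such that $\operatorname{Ext}^1_{\mathcal B}(\mathcal U,\mathcal V)=0$ and every $B\in\mathcal B$ admits short exact sequences $V_B\rightarrowtail U_B\twoheadrightarrow B$ and $B\rightarrowtail V^B\twoheadrightarrow U^B$ with $U_B,U^B\in\mathcal U$ and $V_B,V^B\in\mathcal V$. Let $(\mathcal S,\mathcal T),(\mathcal U,\mathcal V)$ be a twin cotorsion pair on $\mathcal B$, i.e. two cotorsion pairs with $\mathcal S\subseteq\mathcal U$. Put $\mathcal W=\mathcal T\cap\mathcal U$; let $\mathcal B^+$ be the class of objects $B$ admitting a short exact sequence $V_B\rightarrowtail W_B\twoheadrightarrow B$ with $V_B\in\mathcal V$, $W_B\in\mathcal W$, let $\mathcal B^-$ be the class of objects $B$ admitting a short exact sequence $B\rightarrowtail W^B\twoheadrightarrow S^B$ with $W^B\in\mathcal W$, $S^B\in\mathcal S$, and let $\mathcal H=\mathcal B^+\cap\mathcal B^-$. The heart is the ideal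 quotient $\underline{\mathcal H}=\mathcal H/\mathcal W$: its objects are those of $\mathcal H$, and its morphisms are the classes $\underline f$ of morphisms $f$ of $\mathcal H$ modulo those factoring through an object of $\mathcal W$. Then $\underline{\mathcal H}$ is preabelian: it is additive and every morphism in it has a kernel and a cokernel. These can be constructed as follows, for every morphism $f:A\to B$ in $\mathcal H$. (Cokernel) Choose a short exact sequence $A\overset{w^A}{\rightarrowtail}W^A\twoheadrightarrow S^A$ with $W^A\in\mathcal W$, $S^A\in\mathcal S$, and let $c_f:B\to C_f$ be the push-out of $w^A$ along $f$. Choose short exact sequences $V\rightarrowtail U\twoheadrightarrow C_f$ and $U\rightarrowtail T\twoheadrightarrow S$ with $V\in\mathcal V$, $U\in\mathcal U$, $T\in\mathcal T$, $S\in\mathcal S$, and let $c_f^+:C_f\to C_f^+$ be the push-out of $U\rightarrowtail T$ along $U\twoheadrightarrow C_f$. Such choices exist, and for all of them $C_f^+\in\mathcal H$ and $\underline{c_f^+c_f}:B\to C_f^+$ is a cokernel of $\underline f$ in $\underline{\mathcal H}$. (Kernel) Dually, choose a short exact sequence $V_B\rightarrowtail W_B\overset{w_B}{\twoheadrightarrow}B$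 with $V_B\in\mathcal V$, $W_B\in\mathcal W$, and let $k_f:K_f\to A$ be the pull-back of $w_B$ along $f$. Choose short exact sequences $K_f\rightarrowtail T\twoheadrightarrow S$ and $V\rightarrowtail U\twoheadrightarrow T$ with $T\in\mathcal T$, $S\in\mathcal S$, $V\in\mathcal V$, $U\in\mathcal U$, and let $k_f^-:K_f^-\to K_f$ be the pull-back of $U\twoheadrightarrow T$ along $K_f\rightarrowtail T$. Such choices exist, and for all of them $K_f^-\in\mathcal H$ and $\underline{k_fk_f^-}:K_f^-\to A$ is a kernel of $\underline f$ in $\underline{\mathcal H}$. -/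

import Mathlib

open CategoryTheory CategoryTheory.Limits

universe v u

namespace TwinCotorsion

attribute [local instance] hasBinaryBiproducts_of_finite_biproducts

section General

variable (C : Type u) [Category.{v} C] [Preadditive C]

/-- A Krull-Schmidt category: every object is a finite direct sum of objects
whose endomorphism rings are local. -/
def IsKrullSchmidt [HasFiniteBiproducts C] : Prop :=
  ∀ X : C, ∃ (n : ℕ) (F : Fin n → C),
    (∀ i, IsLocalRing (End (F i))) ∧ Nonempty (X ≅ ⨁ F)

/-- A preadditive category is preabelian if it is additive (it has finite direct sums, the empty
one included) and every morphism has a kernel and a cokernel. -/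
structure IsPreabelian : Prop where
  hasFiniteBiproducts : HasFiniteBiproducts C
  hasKernels : HasKernels C
  hasCokernels : HasCokernels C

/-- A full additive subcategory closed under isomorphisms and direct summands. -/
structure IsAdditiveSummandClosed [HasFiniteBiproducts C] (P : ObjectProperty C) : Prop where
  of_isZero : ∀ {X : C}, IsZero X → P X
  of_iso : ∀ {X Y : C}, (X ≅ Y) → P X → P Y
  sum : ∀ {X Y : C}, P X → P Y → P (X ⊞ Y)
  summand : ∀ {X Y : C}, P (X ⊞ Y) → P X

/-- An exact structure on an additive category: a class `conf` of weak short exact sequences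
(kernel-cokernel pairs), the short exact sequences, closed under isomorphisms, direct sums and
direct summands, such that identities are inflations and deflations, inflations and deflations
are closed under composition, deflations have pull-backs along all morphisms, which are again
deflations, and inflations have push-outs along all morphisms, which are again inflations. -/
structure ExactStructure [HasFiniteBiproducts C] where
  /-- The class of short exact sequences. -/
  conf : ObjectProperty (ShortComplex C)
  isKernel : ∀ {X : ShortComplex C}, conf X → Nonempty (IsLimit (KernelFork.ofι X.f X.zero))
  isCokernel : ∀ {X : ShortComplex C}, conf X →
    Nonempty (IsColimit (CokernelCofork.ofπ X.g X.zero))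
  conf_of_iso : ∀ {X Y : ShortComplex C}, (X ≅ Y) → conf X → conf Y
  conf_biprod : ∀ {X Y : ShortComplex C}, conf X → conf Y →
    conf (ShortComplex.mk (biprod.map X.f Y.f) (biprod.map X.g Y.g) (by ext <;> simp))
  conf_of_biprod : ∀ {X Y : ShortComplex C},
    conf (ShortComplex.mk (biprod.map X.f Y.f) (biprod.map X.g Y.g) (by ext <;> simp)) → conf X
  id_inflation : ∀ X : C, ∃ (Z : C) (d : X ⟶ Z) (w : 𝟙 X ≫ d = 0), conf (ShortComplex.mk (𝟙 X) d w)
  id_deflation : ∀ Z : C, ∃ (X : C) (i : X ⟶ Z) (w : i ≫ 𝟙 Z = 0), conf (ShortComplex.mk i (𝟙 Z) w)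
  comp_inflation : ∀ {X Y Z : C} (i : X ⟶ Y) (j : Y ⟶ Z),
    (∃ (Q : C) (d : Y ⟶ Q) (w : i ≫ d = 0), conf (ShortComplex.mk i d w)) →
    (∃ (Q : C) (d : Z ⟶ Q) (w : j ≫ d = 0), conf (ShortComplex.mk j d w)) →
    ∃ (Q : C) (d : Z ⟶ Q) (w : (i ≫ j) ≫ d = 0), conf (ShortComplex.mk (i ≫ j) d w)
  comp_deflation : ∀ {X Y Z : C} (d : X ⟶ Y) (e : Y ⟶ Z),
    (∃ (K : C) (i : K ⟶ X) (w : i ≫ d = 0), conf (ShortComplex.mk i d w)) →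
    (∃ (K : C) (i : K ⟶ Y) (w : i ≫ e = 0), conf (ShortComplex.mk i e w)) →
    ∃ (K : C) (i : K ⟶ X) (w : i ≫ d ≫ e = 0), conf (ShortComplex.mk i (d ≫ e) w)
  pullback : ∀ {X : ShortComplex C}, conf X → ∀ {Z' : C} (f : Z' ⟶ X.X₃),
    ∃ (Y' : C) (f' : Y' ⟶ X.X₂) (d' : Y' ⟶ Z'), IsPullback f' d' X.g f ∧
      ∃ (K : C) (i : K ⟶ Y') (w : i ≫ d' = 0), conf (ShortComplex.mk i d' w)
  pushout : ∀ {X : ShortComplex C}, conf X → ∀ {X' : C} (g : X.X₁ ⟶ X'),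
    ∃ (Y' : C) (g' : X.X₂ ⟶ Y') (i' : X' ⟶ Y'), IsPushout X.f g g' i' ∧
      ∃ (Q : C) (d : Y' ⟶ Q) (w : i' ≫ d = 0), conf (ShortComplex.mk i' d w)

end General

namespace ExactStructure

variable {C : Type u} [Category.{v} C] [Preadditive C] [HasFiniteBiproducts C]
  (E : ExactStructure C)

/-- `X ⟶ Y ⟶ Z` (with morphisms `i` and `d`) is a short exact sequence. -/
def IsShortExact {X Y Z : C} (i : X ⟶ Y) (d : Y ⟶ Z) : Prop :=
  ∃ w : i ≫ d = 0, E.conf (ShortComplex.mk i d w)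

/-- Deflations. -/
def IsDeflation {Y Z : C} (d : Y ⟶ Z) : Prop :=
  ∃ (X : C) (i : X ⟶ Y), E.IsShortExact i d

/-- Inflations. -/
def IsInflation {X Y : C} (i : X ⟶ Y) : Prop :=
  ∃ (Z : C) (d : Y ⟶ Z), E.IsShortExact i d

/-- Projective objects of an exact category. -/
def IsProjective (P : C) : Prop :=
  ∀ {X Y : C} (f : X ⟶ Y), E.IsDeflation f → ∀ g : P ⟶ Y, ∃ h : P ⟶ X, h ≫ f = g

/-- Injective objects of an exact category. -/
def IsInjective (I : C) : Prop :=
  ∀ {X Y : C} (f : X ⟶ Y), E.IsInflation f → ∀ g : X ⟶ I, ∃ h : Y ⟶ I, f ≫ h = g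

/-- Every object is the target of a deflation from a projective object. -/
def HasEnoughProjectives : Prop :=
  ∀ X : C, ∃ (P : C) (p : P ⟶ X), E.IsProjective P ∧ E.IsDeflation p

/-- Every object is the source of an inflation into an injective object. -/
def HasEnoughInjectives : Prop :=
  ∀ X : C, ∃ (I : C) (j : X ⟶ I), E.IsInjective I ∧ E.IsInflation j

/-- `Ext¹(Z, X) = 0` (Yoneda extensions): every short exact sequence `X ⟶ Y ⟶ Z` splits. -/
def ExtVanishes (Z X : C) : Prop :=
  ∀ {Y : C} (i : X ⟶ Y) (d : Y ⟶ Z) (w : i ≫ d = 0), E.conf (ShortComplex.mk i d w) →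
    Nonempty (ShortComplex.mk i d w).Splitting

/-- `(U, V)` is a cotorsion pair. -/
structure IsCotorsionPair (U V : ObjectProperty C) : Prop where
  left : IsAdditiveSummandClosed C U
  right : IsAdditiveSummandClosed C V
  ext_vanishes : ∀ {X Y : C}, U X → V Y → E.ExtVanishes X Y
  exists_left : ∀ B : C, ∃ (VB UB : C) (i : VB ⟶ UB) (d : UB ⟶ B),
    V VB ∧ U UB ∧ E.IsShortExact i d
  exists_right : ∀ B : C, ∃ (VB UB : C) (i : B ⟶ VB) (d : VB ⟶ UB),
    V VB ∧ U UB ∧ E.IsShortExact i d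

end ExactStructure

/-- A twin cotorsion pair `(S, T)`, `(U, V)`: two cotorsion pairs with `S ⊆ U`. -/
structure TwinCotorsionPair {C : Type u} [Category.{v} C] [Preadditive C] [HasFiniteBiproducts C]
    (E : ExactStructure C) where
  /-- The left class of the first cotorsion pair. -/
  S : ObjectProperty C
  /-- The right class of the first cotorsion pair. -/
  T : ObjectProperty C
  /-- The left class of the second cotorsion pair. -/
  U : ObjectProperty C
  /-- The right class of the second cotorsion pair. -/
  V : ObjectProperty C
  cotorsion_ST : E.IsCotorsionPair S T
  cotorsion_UV : E.IsCotorsionPair U V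
  le : S ≤ U

namespace TwinCotorsionPair

variable {C : Type u} [Category.{v} C] [Preadditive C] [HasFiniteBiproducts C]
  {E : ExactStructure C} (t : TwinCotorsionPair E)

/-- `W = T ∩ U`. -/
def W : ObjectProperty C := fun X => t.T X ∧ t.U X

/-- `B⁺`: the objects `X` with a short exact sequence `V_X ⟶ U_X ⟶ X`, where `U_X ∈ W` and
`V_X ∈ V`. -/
def Bplus : ObjectProperty C := fun X =>
  ∃ (VX UX : C) (i : VX ⟶ UX) (d : UX ⟶ X), t.V VX ∧ t.W UX ∧ E.IsShortExact i d

/-- `B⁻`: the objects `X` with a short exact sequence `X ⟶ T^X ⟶ S^X`, where `T^X ∈ W` and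
`S^X ∈ S`. -/
def Bminus : ObjectProperty C := fun X =>
  ∃ (TX SX : C) (i : X ⟶ TX) (d : TX ⟶ SX), t.W TX ∧ t.S SX ∧ E.IsShortExact i d

/-- `H = B⁺ ∩ B⁻`. -/
def H : ObjectProperty C := fun X => t.Bplus X ∧ t.Bminus X

/-- Two morphisms of the full subcategory `H` are identified if their difference factors through
an object of `W`. -/
def heartRel : HomRel t.H.FullSubcategory := fun X Y f g =>
  ∃ (Z : C) (_ : t.W Z) (a : X.obj ⟶ Z) (b : Z ⟶ Y.obj), f.hom - g.hom = a ≫ b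

lemma W_of_isZero {X : C} (hX : IsZero X) : t.W X :=
  ⟨t.cotorsion_ST.right.of_isZero hX, t.cotorsion_UV.left.of_isZero hX⟩

lemma W_biprod {X Y : C} (hX : t.W X) (hY : t.W Y) : t.W (X ⊞ Y) :=
  ⟨t.cotorsion_ST.right.sum hX.1 hY.1, t.cotorsion_UV.left.sum hX.2 hY.2⟩

lemma heartRel_add {X Y : t.H.FullSubcategory} {f₁ f₂ g₁ g₂ : X ⟶ Y}
    (h : t.heartRel f₁ f₂) (h' : t.heartRel g₁ g₂) : t.heartRel (f₁ + g₁) (f₂ + g₂) := by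
  obtain ⟨Z, hZ, a, b, e⟩ := h
  obtain ⟨Z', hZ', a', b', e'⟩ := h'
  refine ⟨Z ⊞ Z', t.W_biprod hZ hZ', biprod.lift a a', biprod.desc b b', ?_⟩
  rw [biprod.lift_desc, ← e, ← e']
  exact add_sub_add_comm _ _ _ _

instance : Congruence t.heartRel where
  equivalence := by
    intro X Y
    refine ⟨fun f => ?_, ?_, ?_⟩
    · exact ⟨_, t.W_of_isZero (isZero_zero C), 0, 0, by simp⟩
    · rintro f g ⟨Z, hZ, a, b, e⟩
      exact ⟨Z, hZ, -a, b, by rw [Preadditive.neg_comp, ← e]; abel⟩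
    · rintro f g h ⟨Z, hZ, a, b, e⟩ ⟨Z', hZ', a', b', e'⟩
      refine ⟨Z ⊞ Z', t.W_biprod hZ hZ', biprod.lift a a', biprod.desc b b', ?_⟩
      rw [biprod.lift_desc, ← e, ← e']
      abel
  comp_left := by
    rintro X Y Z f g g' ⟨Q, hQ, a, b, e⟩
    refine ⟨Q, hQ, f.hom ≫ a, b, ?_⟩
    rw [Category.assoc, ← e]
    simp
  comp_right := by
    rintro X Y Z f f' g ⟨Q, hQ, a, b, e⟩
    refine ⟨Q, hQ, a, b ≫ g.hom, ?_⟩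
    rw [← Category.assoc, ← e]
    simp

/-- The heart `H / W` of the twin cotorsion pair: the objects are those of `H`, the morphisms are
those of `H` modulo the ones that factor through an object of `W`. -/
abbrev Heart : Type u := CategoryTheory.Quotient t.heartRel

/-- The addition of morphisms of the heart is induced from the one of `H`. -/
instance : Preadditive t.Heart :=
  CategoryTheory.Quotient.preadditive t.heartRel fun _ _ _ _ _ _ h h' => t.heartRel_add h h'

/-- The quotient functor from `H` to the heart. -/
abbrev toHeart : t.H.FullSubcategory ⥤ t.Heart := CategoryTheory.Quotient.functor t.heartRel

/-- `c : Y ⟶ C_f` arises from `f : X ⟶ Y` as the push-out along `f` of the first morphism `w` of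
a short exact sequence `X ⟶ W^X ⟶ S^X` with `W^X ∈ W` and `S^X ∈ S`. -/
def IsCone {X Y Cf : C} (f : X ⟶ Y) (c : Y ⟶ Cf) : Prop :=
  ∃ (WX SX : C) (w : X ⟶ WX) (p : WX ⟶ SX) (q : WX ⟶ Cf),
    t.W WX ∧ t.S SX ∧ E.IsShortExact w p ∧ IsPushout w f q c

/-- `b : X ⟶ X⁺` arises from short exact sequences `V_X ⟶ U_X ⟶ X` and `U_X ⟶ T^U ⟶ S^U` with
`V_X ∈ V`, `U_X ∈ U`, `T^U ∈ T`, `S^U ∈ S` as the push-out of `U_X ⟶ T^U` along `U_X ⟶ X`. -/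
def IsPlus {X X' : C} (b : X ⟶ X') : Prop :=
  ∃ (VX UX TU SU : C) (i : VX ⟶ UX) (d : UX ⟶ X) (m : UX ⟶ TU) (p : TU ⟶ SU) (q : TU ⟶ X'),
    t.V VX ∧ t.U UX ∧ t.T TU ∧ t.S SU ∧ E.IsShortExact i d ∧ E.IsShortExact m p ∧
      IsPushout m d q b

/-- `k : K_f ⟶ X` arises from `f : X ⟶ Y` as the pull-back along `f` of the second morphism `w`
of a short exact sequence `V_Y ⟶ W_Y ⟶ Y` with `W_Y ∈ W` and `V_Y ∈ V`. -/
def IsCocone {X Y Kf : C} (f : X ⟶ Y) (k : Kf ⟶ X) : Prop :=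
  ∃ (VY WY : C) (i : VY ⟶ WY) (w : WY ⟶ Y) (q : Kf ⟶ WY),
    t.V VY ∧ t.W WY ∧ E.IsShortExact i w ∧ IsPullback q k w f

/-- `b : X⁻ ⟶ X` arises from short exact sequences `X ⟶ T^X ⟶ S^X` and `V_T ⟶ U_T ⟶ T^X` with
`T^X ∈ T`, `S^X ∈ S`, `V_T ∈ V`, `U_T ∈ U` as the pull-back of `U_T ⟶ T^X` along `X ⟶ T^X`. -/
def IsMinus {X X' : C} (b : X' ⟶ X) : Prop :=
  ∃ (TX SX VT UT : C) (m : X ⟶ TX) (p : TX ⟶ SX) (i : VT ⟶ UT) (d : UT ⟶ TX) (q : X' ⟶ UT),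
    t.T TX ∧ t.S SX ∧ t.V VT ∧ t.U UT ∧ E.IsShortExact m p ∧ E.IsShortExact i d ∧
      IsPullback q b d m

end TwinCotorsionPair

end TwinCotorsion

namespace TwinCotorsion

attribute [local instance] hasBinaryBiproducts_of_finite_biproducts

/-! ### Duality: the opposite exact structure and cotorsion pairs in it. -/

section Opposite

variable {C : Type u} [Category.{v} C] [Preadditive C]

/-! A morphism of the heart is zero exactly when it factors through `W`, so the cokernel claim
splits into existence and uniqueness of factorizations in the exact category. Let `c` be the
push-out of `A ⟶ W^A` along `f`. Then `f ≫ c` factors through `W^A`. Conversely, if `f ≫ g` factors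
through `W`, the vanishing of Ext from `S` to `T` extends its first factor over `W^A`, and the
push-out extends `g` along `c` exactly, not only modulo `W` (`IsCone.exists_desc`). The object `C_f`
lies in `B⁻` but perhaps not in `B⁺`; the morphism `b : C_f ⟶ C_f⁺` repairs this, since every
morphism from `C_f` to an object of `B⁺` extends along `b` (`IsPlus.exists_desc`).

Both `c` and `b` are inflations with cokernel in `S`. This gives uniqueness modulo `W`
(`Bplus.factorsThroughW_of_comp`): the ambiguity is a morphism from an object of `S`, hence of `U`,
to one of `B⁺`, and such morphisms factor through `W`. It also gives `C_f⁺ ∈ B⁻`, because `B⁻` is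
stable under extensions by `S` (`Bminus.of_isShortExact`).

The corresponding facts for kernels are the same ones in the opposite category, where `(V, U)`, `(T,
S)` is a twin cotorsion pair and enough projectives become enough injectives. -/

lemma hasFiniteBiproducts_opposite [HasFiniteBiproducts C] : HasFiniteBiproducts Cᵒᵖ :=
  HasFiniteBiproducts.of_hasFiniteProducts

attribute [local instance] hasFiniteBiproducts_opposite

/-- The binary biproduct in the opposite category is a biproduct in the original one. -/
@[simps]
noncomputable def unopBiprodIso [HasFiniteBiproducts C] (X Y : Cᵒᵖ) :
    (X ⊞ Y).unop ≅ X.unop ⊞ Y.unop where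
  hom := biprod.lift biprod.inl.unop biprod.inr.unop
  inv := biprod.desc biprod.fst.unop biprod.snd.unop
  hom_inv_id := by
    rw [biprod.lift_desc, ← unop_comp, ← unop_comp, ← unop_add, biprod.total, unop_id]
  inv_hom_id := by
    ext <;> simp [← unop_comp]

lemma biprod_map_unop_comp_unopBiprodIso_hom [HasFiniteBiproducts C] {X Y X' Y' : Cᵒᵖ}
    (f : X ⟶ X') (g : Y ⟶ Y') :
    (unopBiprodIso X' Y').hom ≫ biprod.map f.unop g.unop =
      (biprod.map f g).unop ≫ (unopBiprodIso X Y).hom := by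
  apply biprod.hom_ext
  · rw [Category.assoc, Category.assoc, biprod.map_fst, unopBiprodIso_hom, unopBiprodIso_hom,
      biprod.lift_fst_assoc, biprod.lift_fst, ← unop_comp, ← unop_comp, biprod.inl_map]
  · rw [Category.assoc, Category.assoc, biprod.map_snd, unopBiprodIso_hom, unopBiprodIso_hom,
      biprod.lift_snd_assoc, biprod.lift_snd, ← unop_comp, ← unop_comp, biprod.inr_map]

lemma biprod_map_comp_biprod_map_eq_zero [HasFiniteBiproducts C] (X Y : ShortComplex C) :
    biprod.map X.f Y.f ≫ biprod.map X.g Y.g = 0 := by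
  ext <;> simp

/-- Direct sums of short complexes commute with passing to the opposite category. -/
noncomputable def unopBiprodMapIso [HasFiniteBiproducts C] (X Y : ShortComplex Cᵒᵖ) :
    (ShortComplex.mk (biprod.map X.f Y.f) (biprod.map X.g Y.g) (by ext <;> simp)).unop ≅
      ShortComplex.mk (biprod.map X.unop.f Y.unop.f) (biprod.map X.unop.g Y.unop.g)
        (biprod_map_comp_biprod_map_eq_zero X.unop Y.unop) :=
  ShortComplex.isoMk (unopBiprodIso _ _) (unopBiprodIso _ _) (unopBiprodIso _ _)
    (biprod_map_unop_comp_unopBiprodIso_hom _ _) (biprod_map_unop_comp_unopBiprodIso_hom _ _)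

lemma IsAdditiveSummandClosed.op [HasFiniteBiproducts C] {P : ObjectProperty C}
    (h : IsAdditiveSummandClosed C P) : IsAdditiveSummandClosed Cᵒᵖ P.op where
  of_isZero hX := h.of_isZero hX.unop
  of_iso e hX := h.of_iso e.unop.symm hX
  sum hX hY := h.of_iso (unopBiprodIso _ _).symm (h.sum hX hY)
  summand hX := h.summand (h.of_iso (unopBiprodIso _ _) hX)

namespace ExactStructure

variable [HasFiniteBiproducts C] (E : ExactStructure C)

/-- The opposite of an exact structure. -/
def op : ExactStructure Cᵒᵖ where
  conf X := E.conf X.unop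
  isKernel {X} hX := (E.isCokernel hX).map fun h =>
    CokernelCofork.IsColimit.ofπOp _ _ h
  isCokernel {X} hX := (E.isKernel hX).map fun h =>
    KernelFork.IsLimit.ofιOp _ _ h
  conf_of_iso {X Y} e hX := E.conf_of_iso
    ((ShortComplex.unopFunctor C).mapIso e).unop.symm hX
  conf_biprod {X Y} hX hY := E.conf_of_iso (unopBiprodMapIso X Y).symm (E.conf_biprod hX hY)
  conf_of_biprod {X Y} h := E.conf_of_biprod (E.conf_of_iso (unopBiprodMapIso X Y) h)
  id_inflation X := by
    obtain ⟨Z, d, w, h⟩ := E.id_deflation X.unop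
    exact ⟨.op Z, d.op, Quiver.Hom.unop_inj w, h⟩
  id_deflation X := by
    obtain ⟨Z, d, w, h⟩ := E.id_inflation X.unop
    exact ⟨.op Z, d.op, Quiver.Hom.unop_inj w, h⟩
  comp_inflation := by
    rintro X Y Z i j ⟨Q, d, w, h⟩ ⟨Q', d', w', h'⟩
    obtain ⟨K, k, wk, hk⟩ := E.comp_deflation j.unop i.unop
      ⟨Q'.unop, d'.unop, Quiver.Hom.op_inj w', h'⟩ ⟨Q.unop, d.unop, Quiver.Hom.op_inj w, h⟩
    exact ⟨.op K, k.op, Quiver.Hom.unop_inj wk, hk⟩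
  comp_deflation := by
    rintro X Y Z i j ⟨Q, d, w, h⟩ ⟨Q', d', w', h'⟩
    obtain ⟨K, k, wk, hk⟩ := E.comp_inflation j.unop i.unop
      ⟨Q'.unop, d'.unop, Quiver.Hom.op_inj w', h'⟩ ⟨Q.unop, d.unop, Quiver.Hom.op_inj w, h⟩
    exact ⟨.op K, k.op, Quiver.Hom.unop_inj (by simpa using wk), hk⟩
  pullback {X} hX Z' f := by
    obtain ⟨Y, g', i', hp, Q, d, w, h⟩ := E.pushout hX f.unop
    exact ⟨.op Y, g'.op, i'.op, hp.op.flip, .op Q, d.op, Quiver.Hom.unop_inj w, h⟩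
  pushout {X} hX Z' f := by
    obtain ⟨Y, g', i', hp, Q, d, w, h⟩ := E.pullback hX f.unop
    exact ⟨.op Y, g'.op, i'.op, hp.op.flip, .op Q, d.op, Quiver.Hom.unop_inj w, h⟩

variable {E}

lemma IsShortExact.op {X Y Z : C} {i : X ⟶ Y} {d : Y ⟶ Z} (h : E.IsShortExact i d) :
    E.op.IsShortExact d.op i.op :=
  ⟨Quiver.Hom.unop_inj h.1, h.2⟩

lemma IsShortExact.unop {X Y Z : Cᵒᵖ} {i : X ⟶ Y} {d : Y ⟶ Z} (h : E.op.IsShortExact i d) :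
    E.IsShortExact d.unop i.unop :=
  ⟨Quiver.Hom.op_inj h.1, h.2⟩

lemma ExtVanishes.op {Z X : C} (h : E.ExtVanishes Z X) : E.op.ExtVanishes (.op X) (.op Z) :=
  fun i d w hc => (h d.unop i.unop (Quiver.Hom.op_inj w) hc).map fun s => s.op

lemma HasEnoughProjectives.op (h : E.HasEnoughProjectives) : E.op.HasEnoughInjectives := by
  intro X
  obtain ⟨P, p, hP, K, i, hi⟩ := h X.unop
  refine ⟨.op P, p.op, ?_, .op K, i.op, hi.op⟩
  rintro Y Z f ⟨Q, d, hf⟩ g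
  obtain ⟨k, hk⟩ := hP f.unop ⟨_, _, hf.unop⟩ g.unop
  exact ⟨k.op, Quiver.Hom.unop_inj hk⟩

lemma IsCotorsionPair.op {U V : ObjectProperty C} (h : E.IsCotorsionPair U V) :
    E.op.IsCotorsionPair V.op U.op where
  left := h.right.op
  right := h.left.op
  ext_vanishes hX hY := ExtVanishes.op (h.ext_vanishes hY hX)
  exists_left B := by
    obtain ⟨X, Y, i, d, hX, hY, e⟩ := h.exists_right B.unop
    exact ⟨.op Y, .op X, d.op, i.op, hY, hX, e.op⟩
  exists_right B := by
    obtain ⟨X, Y, i, d, hX, hY, e⟩ := h.exists_left B.unop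
    exact ⟨.op Y, .op X, d.op, i.op, hY, hX, e.op⟩

end ExactStructure

end Opposite

/-! ### Short exact sequences: push-outs, pull-backs and lifting by vanishing of Ext. -/

namespace ExactStructure

attribute [local instance] hasFiniteBiproducts_opposite

variable {C : Type u} [Category.{v} C] [Preadditive C] [HasFiniteBiproducts C]
  {E : ExactStructure C}

namespace IsShortExact

variable {X Y Z : C} {i : X ⟶ Y} {d : Y ⟶ Z}

lemma zero (h : E.IsShortExact i d) : i ≫ d = 0 := h.1

lemma mono (h : E.IsShortExact i d) : Mono i := by
  obtain ⟨hl⟩ := E.isKernel h.2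
  exact mono_of_isLimit_fork hl

lemma exists_lift (h : E.IsShortExact i d) {T : C} (f : T ⟶ Y) (hf : f ≫ d = 0) :
    ∃ g : T ⟶ X, g ≫ i = f := by
  obtain ⟨hl⟩ := E.isKernel h.2
  exact ⟨hl.lift (KernelFork.ofι f hf), hl.fac _ WalkingParallelPair.zero⟩

lemma epi (h : E.IsShortExact i d) : Epi d := by
  obtain ⟨hl⟩ := E.isCokernel h.2
  exact epi_of_isColimit_cofork hl

lemma exists_desc (h : E.IsShortExact i d) {T : C} (f : Y ⟶ T) (hf : i ≫ f = 0) :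
    ∃ g : Z ⟶ T, d ≫ g = f := by
  obtain ⟨hl⟩ := E.isCokernel h.2
  exact ⟨hl.desc (CokernelCofork.ofπ f hf), hl.fac _ WalkingParallelPair.one⟩

lemma of_iso (h : E.IsShortExact i d) {X' Y' Z' : C} {i' : X' ⟶ Y'} {d' : Y' ⟶ Z'}
    (e₁ : X ≅ X') (e₂ : Y ≅ Y') (e₃ : Z ≅ Z') (h₁ : e₁.hom ≫ i' = i ≫ e₂.hom)
    (h₂ : e₂.hom ≫ d' = d ≫ e₃.hom) : E.IsShortExact i' d' := by
  have w : i' ≫ d' = 0 := by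
    rw [← cancel_epi e₁.hom, reassoc_of% h₁, h₂, reassoc_of% h.zero, zero_comp, comp_zero]
  exact ⟨w, E.conf_of_iso (ShortComplex.isoMk (S₁ := .mk i d h.1) (S₂ := .mk i' d' w)
    e₁ e₂ e₃ h₁ h₂) h.2⟩

/-- In a short exact sequence, the inflation may be replaced by any kernel of the deflation. -/
lemma of_kernel (h : E.IsShortExact i d) {X' : C} {i' : X' ⟶ Y} (hi : Mono i') (w : i' ≫ d = 0)
    (hl : ∀ {T : C} (f : T ⟶ Y), f ≫ d = 0 → ∃ g : T ⟶ X', g ≫ i' = f) :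
    E.IsShortExact i' d := by
  have := h.mono
  obtain ⟨a, ha⟩ := hl i h.zero
  obtain ⟨b, hb⟩ := h.exists_lift i' w
  refine h.of_iso ⟨a, b, ?_, ?_⟩ (Iso.refl _) (Iso.refl _) (by simpa using ha) (by simp)
  · rw [← cancel_mono i, Category.assoc, hb, ha, Category.id_comp]
  · rw [← cancel_mono i', Category.assoc, ha, hb, Category.id_comp]

/-- In a short exact sequence, the deflation may be replaced by any cokernel of the inflation. -/
lemma of_cokernel (h : E.IsShortExact i d) {Z' : C} {d' : Y ⟶ Z'} (hd : Epi d') (w : i ≫ d' = 0)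
    (hl : ∀ {T : C} (f : Y ⟶ T), i ≫ f = 0 → ∃ g : Z' ⟶ T, d' ≫ g = f) :
    E.IsShortExact i d' :=
  (h.op.of_kernel (i' := d'.op) inferInstance (Quiver.Hom.unop_inj w) fun f hf =>
    (hl f.unop (Quiver.Hom.op_inj hf)).imp' Quiver.Hom.op fun _ hg =>
      Quiver.Hom.unop_inj hg).unop

/-- A pull-back of a deflation is a deflation with the same kernel. -/
lemma of_isPullback (h : E.IsShortExact i d) {Y' Z' : C} {f' : Y' ⟶ Y} {d' : Y' ⟶ Z'}
    {f : Z' ⟶ Z} (hp : IsPullback f' d' d f) :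
    E.IsShortExact (hp.lift i 0 (by rw [h.zero, zero_comp])) d' := by
  -- The axiom yields only some pull-back with some kernel. Uniqueness of pull-backs carries the
  -- sequence over to `d'`, and `of_kernel` then exchanges its inflation for the lift of `i`.
  obtain ⟨Y₀, f₀, d₀, hp₀, K, k, w, hk⟩ := E.pullback h.2 f
  have h₀ : E.IsShortExact k d₀ := ⟨w, hk⟩
  have e : E.IsShortExact (k ≫ (hp₀.isoIsPullback _ _ hp).hom) d' :=
    h₀.of_iso (Iso.refl _) (hp₀.isoIsPullback _ _ hp) (Iso.refl _) (by simp) (by simp)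
  have := h.mono
  refine e.of_kernel ?_ (by simp) fun {T} g hg => ?_
  · have : Mono (hp.lift i 0 (by rw [h.zero, zero_comp]) ≫ f') := by simpa
    exact mono_of_mono _ f'
  · obtain ⟨a, ha⟩ := h.exists_lift (g ≫ f') (by
      rw [Category.assoc, hp.w, reassoc_of% hg, zero_comp])
    exact ⟨a, hp.hom_ext (by simpa using ha) (by simpa using hg.symm)⟩

/-- A push-out of an inflation is an inflation with the same cokernel. -/
lemma of_isPushout (h : E.IsShortExact i d) {X' Y' : C} {f : X ⟶ X'} {f' : Y ⟶ Y'} {i' : X' ⟶ Y'}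
    (hp : IsPushout i f f' i') :
    E.IsShortExact i' (hp.desc d 0 (by rw [h.zero, comp_zero])) := by
  have e := (h.op.of_isPullback hp.op.flip).unop
  convert! e using 1
  refine hp.hom_ext ?_ ?_
  · rw [hp.inl_desc]
    exact Quiver.Hom.op_inj (by simp)
  · rw [hp.inr_desc]
    exact Quiver.Hom.op_inj (by simp)

lemma exists_isPushout (h : E.IsShortExact i d) {X' : C} (f : X ⟶ X') :
    ∃ (Y' : C) (f' : Y ⟶ Y') (i' : X' ⟶ Y'), IsPushout i f f' i' := by
  obtain ⟨Y', f', i', hp, -⟩ := E.pushout h.2 f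
  exact ⟨Y', f', i', hp⟩

lemma exists_isPullback (h : E.IsShortExact i d) {Z' : C} (f : Z' ⟶ Z) :
    ∃ (Y' : C) (f' : Y' ⟶ Y) (d' : Y' ⟶ Z'), IsPullback f' d' d f := by
  obtain ⟨Y', f', i', hp, -⟩ := E.pullback h.2 f
  exact ⟨Y', f', i', hp⟩

/-- The push-out of an inflation `j` along the cokernel of an inflation `i` is a cokernel
of `i ≫ j`. -/
lemma comp_of_isPushout (h : E.IsShortExact i d) {Y' S : C} {j : Y ⟶ Y'} {p : Y' ⟶ S}
    (hj : E.IsShortExact j p) {Z' : C} {q : Y' ⟶ Z'} {b : Z ⟶ Z'} (hp : IsPushout j d q b) :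
    E.IsShortExact (i ≫ j) q := by
  obtain ⟨Q, r, w, hr⟩ := E.comp_inflation i j ⟨_, _, h⟩ ⟨_, _, hj⟩
  have := h.epi
  have hij : E.IsShortExact (i ≫ j) r := ⟨w, hr⟩
  -- The axiom on composites yields only some cokernel `r`; `q` replaces it once its universal
  -- property is read off from the push-out and from `d` being a cokernel of `i`.
  refine hij.of_cokernel ⟨fun f g hfg => hp.hom_ext hfg ?_⟩ ?_ fun f hf => ?_
  · rw [← cancel_epi d, ← reassoc_of% hp.w, hfg, reassoc_of% hp.w]
  · rw [Category.assoc, hp.w, reassoc_of% h.zero, zero_comp]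
  · obtain ⟨g, hg⟩ := h.exists_desc (j ≫ f) (by simpa using hf)
    exact ⟨hp.desc f g hg.symm, by simp⟩

/-- A morphism to the end term of a short exact sequence lifts if the extension group vanishes. -/
lemma exists_lift_of_extVanishes (h : E.IsShortExact i d) {T : C} (hT : E.ExtVanishes T X)
    (f : T ⟶ Z) : ∃ g : T ⟶ Y, g ≫ d = f := by
  obtain ⟨Y', f', d', hp⟩ := h.exists_isPullback f
  obtain ⟨w, hc⟩ := h.of_isPullback hp
  obtain ⟨s⟩ := hT _ _ w hc
  exact ⟨s.s ≫ f', by rw [Category.assoc, hp.w, ← Category.assoc]; erw [s.s_g]; simp⟩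

/-- A morphism from the first term of a short exact sequence extends if the extension group
vanishes. -/
lemma exists_extend_of_extVanishes (h : E.IsShortExact i d) {T : C} (hT : E.ExtVanishes Z T)
    (f : X ⟶ T) : ∃ g : Y ⟶ T, i ≫ g = f := by
  obtain ⟨g, hg⟩ := h.op.exists_lift_of_extVanishes (ExtVanishes.op hT) f.op
  exact ⟨g.unop, Quiver.Hom.op_inj hg⟩

/-- If the end term of a short exact sequence lifts, then it is a direct summand. -/
lemma nonempty_splitting (h : E.IsShortExact i d) (s : Z ⟶ Y) (hs : s ≫ d = 𝟙 Z) :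
    Nonempty (ShortComplex.mk i d h.1).Splitting := by
  have := h.mono
  obtain ⟨r, hr⟩ := h.exists_lift (𝟙 Y - d ≫ s) (by simp [hs])
  exact ⟨{ r := r, s := s, f_r := by
            rw [← cancel_mono i]
            simp [hr, reassoc_of% h.zero]
           s_g := hs, id := by simp [hr] }⟩

end IsShortExact

/-! ### Cotorsion pairs: orthogonality and extension closure. -/

namespace IsCotorsionPair

variable {U V : ObjectProperty C} (h : E.IsCotorsionPair U V)
include h

/-- The sequence `VX ⟶ UX ⟶ X` splits, so `X` is a direct summand of `UX`. -/
lemma left_of_extVanishes {X : C} (hX : ∀ Y, V Y → E.ExtVanishes X Y) : U X := by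
  obtain ⟨VX, UX, i, d, hV, hU, w, hc⟩ := h.exists_left X
  obtain ⟨s⟩ := hX _ hV _ _ w hc
  exact h.left.summand (h.left.of_iso (s.isoBinaryBiproduct ≪≫ biprod.braiding _ _) hU)

lemma right_of_extVanishes {X : C} (hX : ∀ Y, U Y → E.ExtVanishes Y X) : V X :=
  h.op.left_of_extVanishes (X := .op X) fun Y hY => ExtVanishes.op (hX Y.unop hY)

/-- The left class of a cotorsion pair is closed under extensions. -/
lemma left_of_extension (hI : E.HasEnoughInjectives) {X Y Z : C} {i : X ⟶ Y} {d : Y ⟶ Z}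
    (e : E.IsShortExact i d) (hX : U X) (hZ : U Z) : U Y := by
  refine h.left_of_extVanishes fun V₀ hV => ?_
  intro M m p w hm
  have hmp : E.IsShortExact m p := ⟨w, hm⟩
  obtain ⟨I, j, hI, Q, q, hj⟩ := hI V₀
  -- compare `m, p` with the injective presentation `j, q`
  obtain ⟨a, ha⟩ := hI m ⟨_, _, hmp⟩ j
  obtain ⟨b, hb⟩ := hmp.exists_desc (a ≫ q) (by rw [reassoc_of% ha, hj.zero])
  -- The injective presentation stands in for the long exact sequence of Ext: it suffices to lift
  -- `b` along `q`. Lift it on `X`, extend over `Y` by injectivity of `I`, and note that the error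
  -- vanishes on `X`; it thus descends to `Z`, where it lifts again.
  obtain ⟨c, hc⟩ := hj.exists_lift_of_extVanishes (h.ext_vanishes hX hV) (i ≫ b)
  obtain ⟨c', hc'⟩ := hI i ⟨_, _, e⟩ c
  obtain ⟨g, hg⟩ := e.exists_desc (b - c' ≫ q) (by
    rw [Preadditive.comp_sub, reassoc_of% hc', hc, sub_self])
  obtain ⟨g', hg'⟩ := hj.exists_lift_of_extVanishes (h.ext_vanishes hZ hV) g
  have hk : (c' + d ≫ g') ≫ q = b := by
    rw [Preadditive.add_comp, Category.assoc, hg', hg, add_sub_cancel]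
  -- Subtracting the lift of `b` from `a` gives a morphism killed by `q`, so it lands in `V₀`. It is
  -- a retraction of `m` because `m ≫ p = 0`.
  obtain ⟨r, hr⟩ := hj.exists_lift (a - p ≫ (c' + d ≫ g')) (by
    rw [Preadditive.sub_comp, Category.assoc, hk, hb, sub_self])
  have := hj.mono
  have hmr : m ≫ r = 𝟙 _ := by
    rw [← cancel_mono j, Category.assoc, hr]
    simp [ha, reassoc_of% w]
  exact ⟨(hmp.op.nonempty_splitting r.op (Quiver.Hom.unop_inj hmr)).some.unop⟩

end IsCotorsionPair

end ExactStructure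

end TwinCotorsion

namespace TwinCotorsion

attribute [local instance] hasBinaryBiproducts_of_finite_biproducts

/-! ### Twin cotorsion pairs: duality and factorization through `W`. -/

namespace TwinCotorsionPair

section

attribute [local instance] hasFiniteBiproducts_opposite

variable {C : Type u} [Category.{v} C] [Preadditive C] [HasFiniteBiproducts C]
  {E : ExactStructure C} (t : TwinCotorsionPair E)

/-- Ext from `U` to `V` vanishes and `S ≤ U`, while `T` contains everything right orthogonal to `S`.
-/
lemma V_le_T : t.V ≤ t.T := fun _ hX =>
  t.cotorsion_ST.right_of_extVanishes fun _ hY =>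
    t.cotorsion_UV.ext_vanishes (t.le _ hY) hX

/-- The opposite of the twin cotorsion pair `(S, T)`, `(U, V)` consists of `(V, U)` and `(T, S)`
in the opposite category. -/
def op : TwinCotorsionPair E.op where
  S := t.V.op
  T := t.U.op
  U := t.T.op
  V := t.S.op
  cotorsion_ST := t.cotorsion_UV.op
  cotorsion_UV := t.cotorsion_ST.op
  le := fun _ hX => t.V_le_T _ hX

/-- The morphisms that factor through an object of `W`. -/
def FactorsThroughW {X Y : C} (f : X ⟶ Y) : Prop :=
  ∃ (Z : C) (_ : t.W Z) (a : X ⟶ Z) (b : Z ⟶ Y), f = a ≫ b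

variable {t}

lemma FactorsThroughW.add {X Y : C} {f g : X ⟶ Y} (hf : t.FactorsThroughW f)
    (hg : t.FactorsThroughW g) : t.FactorsThroughW (f + g) := by
  obtain ⟨Z, hZ, a, b, rfl⟩ := hf
  obtain ⟨Z', hZ', a', b', rfl⟩ := hg
  exact ⟨Z ⊞ Z', t.W_biprod hZ hZ', biprod.lift a a', biprod.desc b b', by simp⟩

lemma FactorsThroughW.op {X Y : C} {f : X ⟶ Y} (hf : t.FactorsThroughW f) :
    t.op.FactorsThroughW f.op := by
  obtain ⟨Z, hZ, a, b, rfl⟩ := hf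
  exact ⟨.op Z, ⟨hZ.2, hZ.1⟩, b.op, a.op, rfl⟩

lemma FactorsThroughW.unop {X Y : Cᵒᵖ} {f : X ⟶ Y} (hf : t.op.FactorsThroughW f) :
    t.FactorsThroughW f.unop := by
  obtain ⟨Z, hZ, a, b, rfl⟩ := hf
  exact ⟨Z.unop, ⟨hZ.2, hZ.1⟩, b.unop, a.unop, rfl⟩

lemma Bplus.op {X : C} (hX : t.Bplus X) : t.op.Bminus (.op X) := by
  obtain ⟨V, W, i, d, hV, hW, e⟩ := hX
  exact ⟨.op W, .op V, d.op, i.op, ⟨hW.2, hW.1⟩, hV, e.op⟩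

lemma Bminus.op {X : C} (hX : t.Bminus X) : t.op.Bplus (.op X) := by
  obtain ⟨W, S, i, d, hW, hS, e⟩ := hX
  exact ⟨.op S, .op W, d.op, i.op, hS, ⟨hW.2, hW.1⟩, e.op⟩

lemma Bplus.unop {X : Cᵒᵖ} (hX : t.op.Bplus X) : t.Bminus X.unop := by
  obtain ⟨V, W, i, d, hV, hW, e⟩ := hX
  exact ⟨W.unop, V.unop, d.unop, i.unop, ⟨hW.2, hW.1⟩, hV, e.unop⟩

lemma Bminus.unop {X : Cᵒᵖ} (hX : t.op.Bminus X) : t.Bplus X.unop := by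
  obtain ⟨W, S, i, d, hW, hS, e⟩ := hX
  exact ⟨S.unop, W.unop, d.unop, i.unop, hS, ⟨hW.2, hW.1⟩, e.unop⟩

lemma IsCocone.op {X Y K : C} {f : X ⟶ Y} {k : K ⟶ X} (h : t.IsCocone f k) :
    t.op.IsCone f.op k.op := by
  obtain ⟨V, W, i, w, q, hV, hW, e, hp⟩ := h
  exact ⟨.op W, .op V, w.op, i.op, q.op, ⟨hW.2, hW.1⟩, hV, e.op, hp.op.flip⟩

lemma IsMinus.op {X X' : C} {b : X' ⟶ X} (h : t.IsMinus b) : t.op.IsPlus b.op := by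
  obtain ⟨T, S, V, U, m, p, i, d, q, hT, hS, hV, hU, e, e', hp⟩ := h
  exact ⟨.op S, .op T, .op U, .op V, p.op, m.op, d.op, i.op, q.op, hS, hT, hU, hV, e.op, e'.op,
    hp.op.flip⟩

/-- A morphism from an object of `U` to an object of `B⁺` factors through `W`. -/
lemma Bplus.factorsThroughW_of_U {X Y : C} (hY : t.Bplus Y) (hX : t.U X) (f : X ⟶ Y) :
    t.FactorsThroughW f := by
  obtain ⟨V, W, i, d, hV, hW, e⟩ := hY
  obtain ⟨g, hg⟩ := e.exists_lift_of_extVanishes (t.cotorsion_UV.ext_vanishes hX hV) f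
  exact ⟨W, hW, g, d, hg.symm⟩

/-- Morphisms into objects of `B⁺` are determined, modulo `W`, by their restriction along an
inflation with cokernel in `S`. -/
lemma Bplus.factorsThroughW_of_comp {X X' S Z : C} {b : X ⟶ X'} {p : X' ⟶ S}
    (hZ : t.Bplus Z) (hS : t.S S) (e : E.IsShortExact b p) {h : X' ⟶ Z}
    (hb : t.FactorsThroughW (b ≫ h)) : t.FactorsThroughW h := by
  obtain ⟨W, hW, a, c, hac⟩ := hb
  -- Extending `a` to `X'` produces a morphism through `W` that agrees with `h` on `X`. The
  -- difference descends to `S`, and from there any morphism to `Z` factors through `W`.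
  obtain ⟨a', rfl⟩ := e.exists_extend_of_extVanishes (t.cotorsion_ST.ext_vanishes hS hW.1) a
  obtain ⟨g, hg⟩ := e.exists_desc (h - a' ≫ c) (by
    rw [Preadditive.comp_sub, hac, Category.assoc, sub_self])
  obtain ⟨W', hW', x, y, rfl⟩ := hZ.factorsThroughW_of_U (t.le _ hS) g
  have : h = a' ≫ c + (p ≫ x) ≫ y := by rw [Category.assoc, hg, add_sub_cancel]
  rw [this]
  exact FactorsThroughW.add ⟨W, hW, a', c, rfl⟩ ⟨W', hW', p ≫ x, y, rfl⟩

/-- `B⁻` is closed under extensions by objects of `S`. -/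
lemma Bminus.of_isShortExact (hI : E.HasEnoughInjectives) {X X' S : C} {b : X ⟶ X'} {p : X' ⟶ S}
    (hX : t.Bminus X) (hS : t.S S) (e : E.IsShortExact b p) : t.Bminus X' := by
  obtain ⟨W, S₁, w, r, hW, hS₁, ew⟩ := hX
  -- The push-out `Q` is an extension of `S` by `W`, hence in `U`, and contains `X'` with cokernel
  -- `S₁`.
  obtain ⟨Q, f, g, hp⟩ := e.exists_isPushout w
  have eW := e.of_isPushout hp
  have eX' := ew.of_isPushout hp.flip
  have hQ : t.U Q := t.cotorsion_UV.left_of_extension hI eW hW.2 (t.le _ hS)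
  -- `Q` need not be in `T`, so it is embedded further. The larger object stays in `U`, and the
  -- cokernel `R` of the composite from `X'` is an extension of `S₂` by `S₁`, hence in `S`.
  obtain ⟨T, S₂, j, q, hT, hS₂, ej⟩ := t.cotorsion_ST.exists_right Q
  have hTU : t.U T := t.cotorsion_UV.left_of_extension hI ej hQ (t.le _ hS₂)
  obtain ⟨R, k, l, hp'⟩ := ej.exists_isPushout (hp.flip.desc r 0 (by rw [ew.zero, comp_zero]))
  exact ⟨T, R, f ≫ j, k, ⟨hT, hTU⟩,
    t.cotorsion_ST.left_of_extension hI (ej.of_isPushout hp') hS₁ hS₂,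
    eX'.comp_of_isPushout ej hp'⟩

variable (t) in
/-- Every object has a reflection into `B⁺`. -/
lemma exists_isPlus (X : C) : ∃ (X' : C) (b : X ⟶ X'), t.IsPlus b := by
  obtain ⟨V, U, i, d, hV, hU, e⟩ := t.cotorsion_UV.exists_left X
  obtain ⟨T, S, m, p, hT, hS, e'⟩ := t.cotorsion_ST.exists_right U
  obtain ⟨X', q, b, hp⟩ := e'.exists_isPushout d
  exact ⟨X', b, V, U, T, S, i, d, m, p, q, hV, hU, hT, hS, e, e', hp⟩

/-! ### Reflections into `B⁺`, cones and cokernels. -/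

namespace IsPlus

variable {X X' : C} {b : X ⟶ X'} (h : t.IsPlus b)
include h

lemma exists_isShortExact : ∃ (S : C) (p : X' ⟶ S), t.S S ∧ E.IsShortExact b p := by
  obtain ⟨V, U, T, S, i, d, m, p, q, hV, hU, hT, hS, e, e', hp⟩ := h
  exact ⟨S, _, hS, e'.of_isPushout hp⟩

/-- The push-out makes `V ⟶ T ⟶ X'` short exact, and `T` lies in `U` as an extension of `S` by `U`.
-/
lemma bplus (hI : E.HasEnoughInjectives) : t.Bplus X' := by
  obtain ⟨V, U, T, S, i, d, m, p, q, hV, hU, hT, hS, e, e', hp⟩ := h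
  exact ⟨V, T, _, q, hV, ⟨hT, t.cotorsion_UV.left_of_extension hI e' hU (t.le _ hS)⟩,
    e.comp_of_isPushout e' hp⟩

lemma bminus (hI : E.HasEnoughInjectives) (hX : t.Bminus X) : t.Bminus X' := by
  obtain ⟨S, p, hS, e⟩ := h.exists_isShortExact
  exact hX.of_isShortExact hI hS e

/-- Lift `d ≫ f` to the `W`-term over `Y`, extend the lift from `U` to `T`, and glue with `f` on the
push-out. The two steps use the two cotorsion pairs in turn. -/
lemma exists_desc {Y : C} (hY : t.Bplus Y) (f : X ⟶ Y) : ∃ g : X' ⟶ Y, b ≫ g = f := by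
  obtain ⟨V, U, T, S, i, d, m, p, q, hV, hU, hT, hS, e, e', hp⟩ := h
  obtain ⟨V', W, i', w, hV', hW, ew⟩ := hY
  obtain ⟨g, hg⟩ := ew.exists_lift_of_extVanishes (t.cotorsion_UV.ext_vanishes hU hV') (d ≫ f)
  obtain ⟨g', rfl⟩ := e'.exists_extend_of_extVanishes (t.cotorsion_ST.ext_vanishes hS hW.1) g
  exact ⟨hp.desc (g' ≫ w) f (by rw [← hg, Category.assoc]), by simp⟩

end IsPlus

lemma Bminus.exists_isCone {X Y : C} (hX : t.Bminus X) (f : X ⟶ Y) :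
    ∃ (Cf : C) (c : Y ⟶ Cf), t.IsCone f c := by
  obtain ⟨W, S, w, p, hW, hS, e⟩ := hX
  obtain ⟨Q, q, c, hp⟩ := e.exists_isPushout f
  exact ⟨Q, c, W, S, w, p, q, hW, hS, e, hp⟩

namespace IsCone

variable {X Y Cf : C} {f : X ⟶ Y} {c : Y ⟶ Cf} (h : t.IsCone f c)
include h

lemma exists_isShortExact : ∃ (S : C) (p : Cf ⟶ S), t.S S ∧ E.IsShortExact c p := by
  obtain ⟨W, S, w, p, q, hW, hS, e, hp⟩ := h
  exact ⟨S, _, hS, e.of_isPushout hp⟩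

lemma factorsThroughW_comp {Z : C} (b : Cf ⟶ Z) : t.FactorsThroughW (f ≫ c ≫ b) := by
  obtain ⟨W, S, w, p, q, hW, hS, e, hp⟩ := h
  exact ⟨W, hW, w, q ≫ b, by rw [← reassoc_of% hp.w]⟩

lemma bminus (hI : E.HasEnoughInjectives) (hY : t.Bminus Y) : t.Bminus Cf := by
  obtain ⟨S, p, hS, e⟩ := h.exists_isShortExact
  exact hY.of_isShortExact hI hS e

/-- Since `W' ∈ T`, the first factor of `f ≫ g` extends along `w`, giving a compatible pair on the
push-out. -/
lemma exists_desc {Z : C} (g : Y ⟶ Z) (hg : t.FactorsThroughW (f ≫ g)) :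
    ∃ l : Cf ⟶ Z, c ≫ l = g := by
  obtain ⟨W, S, w, p, q, hW, hS, e, hp⟩ := h
  obtain ⟨W', hW', a, b, hab⟩ := hg
  obtain ⟨a', rfl⟩ := e.exists_extend_of_extVanishes (t.cotorsion_ST.ext_vanishes hS hW'.1) a
  exact ⟨hp.desc (a' ≫ b) g (by rw [hab, Category.assoc]), by simp⟩

variable {Cf' : C} {b : Cf ⟶ Cf'} (hb : t.IsPlus b)
include hb

lemma exists_desc_comp {Z : C} (hZ : t.Bplus Z) (g : Y ⟶ Z) (hg : t.FactorsThroughW (f ≫ g)) :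
    ∃ l : Cf' ⟶ Z, (c ≫ b) ≫ l = g := by
  obtain ⟨l, rfl⟩ := h.exists_desc g hg
  obtain ⟨l', rfl⟩ := hb.exists_desc hZ l
  exact ⟨l', Category.assoc _ _ _⟩

/-- This is the uniqueness half of the cokernel property: factorization through `W` is propagated
first along `c`, then along `b`. -/
lemma factorsThroughW_of_comp {Z : C} (hZ : t.Bplus Z) (l : Cf' ⟶ Z)
    (hl : t.FactorsThroughW ((c ≫ b) ≫ l)) : t.FactorsThroughW l := by
  obtain ⟨S, p, hS, e⟩ := h.exists_isShortExact
  obtain ⟨S', p', hS', e'⟩ := hb.exists_isShortExact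
  exact hZ.factorsThroughW_of_comp hS' e' (hZ.factorsThroughW_of_comp hS e (by simpa using hl))

end IsCone

/-! ### Coreflections into `B⁻`, cocones and kernels, mostly by duality. -/

variable (t) in
lemma exists_isMinus (X : C) : ∃ (X' : C) (b : X' ⟶ X), t.IsMinus b := by
  obtain ⟨T, S, m, p, hT, hS, e⟩ := t.cotorsion_ST.exists_right X
  obtain ⟨V, U, i, d, hV, hU, e'⟩ := t.cotorsion_UV.exists_left T
  obtain ⟨X', q, b, hp⟩ := e'.exists_isPullback m
  exact ⟨X', b, T, S, V, U, m, p, i, d, q, hT, hS, hV, hU, e, e', hp⟩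

lemma Bplus.exists_isCocone {X Y : C} (hY : t.Bplus Y) (f : X ⟶ Y) :
    ∃ (K : C) (k : K ⟶ X), t.IsCocone f k := by
  obtain ⟨V, W, i, w, hV, hW, e⟩ := hY
  obtain ⟨K, q, k, hp⟩ := e.exists_isPullback f
  exact ⟨K, k, V, W, i, w, q, hV, hW, e, hp⟩

lemma IsMinus.bminus {X X' : C} {b : X' ⟶ X} (h : t.IsMinus b) (hP : E.HasEnoughProjectives) :
    t.Bminus X' :=
  (h.op.bplus hP.op).unop

lemma IsMinus.bplus {X X' : C} {b : X' ⟶ X} (h : t.IsMinus b) (hP : E.HasEnoughProjectives)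
    (hX : t.Bplus X) : t.Bplus X' :=
  (h.op.bminus hP.op hX.op).unop

namespace IsCocone

variable {X Y K : C} {f : X ⟶ Y} {k : K ⟶ X} (h : t.IsCocone f k)
include h

lemma bplus (hP : E.HasEnoughProjectives) (hX : t.Bplus X) : t.Bplus K :=
  (h.op.bminus hP.op hX.op).unop

lemma factorsThroughW_comp {Z : C} (b : Z ⟶ K) : t.FactorsThroughW ((b ≫ k) ≫ f) :=
  (h.op.factorsThroughW_comp b.op).unop

variable {K' : C} {b : K' ⟶ K} (hb : t.IsMinus b)
include hb

lemma exists_lift_comp {Z : C} (hZ : t.Bminus Z) (g : Z ⟶ X) (hg : t.FactorsThroughW (g ≫ f)) :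
    ∃ l : Z ⟶ K', l ≫ b ≫ k = g :=
  (h.op.exists_desc_comp hb.op hZ.op g.op hg.op).imp' Quiver.Hom.unop fun _ hl =>
    Quiver.Hom.op_inj hl

lemma factorsThroughW_of_comp {Z : C} (hZ : t.Bminus Z) (l : Z ⟶ K')
    (hl : t.FactorsThroughW (l ≫ b ≫ k)) : t.FactorsThroughW l :=
  (h.op.factorsThroughW_of_comp hb.op hZ.op l.op hl.op).unop

end IsCocone

end

/-! ### The heart: additivity, cokernels and kernels. -/

section Heart

open ZeroObject

variable {C : Type u} [Category.{v} C] [Preadditive C] [HasFiniteBiproducts C]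
  {E : ExactStructure C} {t : TwinCotorsionPair E}

instance : t.toHeart.Additive where
  map_add := rfl

lemma toHeart_map_eq_zero_iff {X Y : t.H.FullSubcategory} (f : X ⟶ Y) :
    t.toHeart.map f = 0 ↔ t.FactorsThroughW f.hom := by
  rw [← t.toHeart.map_zero, CategoryTheory.Quotient.functor_map_eq_iff]
  change t.FactorsThroughW (f.hom - 0) ↔ _
  rw [sub_zero]

/-- The image in the heart of a cone followed by a reflection into `B⁺` is a cokernel. -/
lemma IsCone.nonempty_isColimit {X Y Q : t.H.FullSubcategory} {f : X ⟶ Y} {Cf : C}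
    {c : Y.obj ⟶ Cf} (h : t.IsCone f.hom c) {b : Cf ⟶ Q.obj} (hb : t.IsPlus b) :
    ∃ w : t.toHeart.map f ≫ t.toHeart.map (ObjectProperty.homMk (c ≫ b) : Y ⟶ Q) = 0,
      Nonempty (IsColimit (CokernelCofork.ofπ
        (t.toHeart.map (ObjectProperty.homMk (c ≫ b) : Y ⟶ Q)) w)) := by
  have w : t.toHeart.map f ≫ t.toHeart.map (ObjectProperty.homMk (c ≫ b) : Y ⟶ Q) = 0 := by
    rw [← Functor.map_comp, toHeart_map_eq_zero_iff]
    exact h.factorsThroughW_comp b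
  refine ⟨w, ⟨?_⟩⟩
  -- With the epimorphism property in hand, the universal property needs only the existence of
  -- factorizations.
  have : Epi (t.toHeart.map (ObjectProperty.homMk (c ≫ b) : Y ⟶ Q)) := by
    refine Preadditive.epi_of_cancel_zero _ ?_
    rintro ⟨Z⟩ l hl
    obtain ⟨l, rfl⟩ := t.toHeart.map_surjective l
    rw [← Functor.map_comp, toHeart_map_eq_zero_iff] at hl
    rw [toHeart_map_eq_zero_iff]
    exact h.factorsThroughW_of_comp hb Z.property.1 l.hom hl
  refine CokernelCofork.IsColimit.ofπ' _ _ fun {Z} g hg => Nonempty.some ?_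
  obtain ⟨Z⟩ := Z
  obtain ⟨g, rfl⟩ := t.toHeart.map_surjective g
  rw [← Functor.map_comp, toHeart_map_eq_zero_iff] at hg
  obtain ⟨l, hl⟩ := h.exists_desc_comp hb Z.property.1 g.hom hg
  exact ⟨⟨t.toHeart.map (ObjectProperty.homMk l), by
    rw [← Functor.map_comp]
    exact congrArg t.toHeart.map (ObjectProperty.hom_ext _ hl)⟩⟩

/-- The image in the heart of a coreflection into `B⁻` followed by a cocone is a kernel. -/
lemma IsCocone.nonempty_isLimit {X Y Q : t.H.FullSubcategory} {f : X ⟶ Y} {K : C}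
    {k : K ⟶ X.obj} (h : t.IsCocone f.hom k) {b : Q.obj ⟶ K} (hb : t.IsMinus b) :
    ∃ w : t.toHeart.map (ObjectProperty.homMk (b ≫ k) : Q ⟶ X) ≫ t.toHeart.map f = 0,
      Nonempty (IsLimit (KernelFork.ofι
        (t.toHeart.map (ObjectProperty.homMk (b ≫ k) : Q ⟶ X)) w)) := by
  have w : t.toHeart.map (ObjectProperty.homMk (b ≫ k) : Q ⟶ X) ≫ t.toHeart.map f = 0 := by
    rw [← Functor.map_comp, toHeart_map_eq_zero_iff]
    exact h.factorsThroughW_comp b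
  refine ⟨w, ⟨?_⟩⟩
  have : Mono (t.toHeart.map (ObjectProperty.homMk (b ≫ k) : Q ⟶ X)) := by
    refine Preadditive.mono_of_cancel_zero _ ?_
    rintro ⟨Z⟩ l hl
    obtain ⟨l, rfl⟩ := t.toHeart.map_surjective l
    rw [← Functor.map_comp, toHeart_map_eq_zero_iff] at hl
    rw [toHeart_map_eq_zero_iff]
    exact h.factorsThroughW_of_comp hb Z.property.2 l.hom hl
  refine KernelFork.IsLimit.ofι' _ _ fun {Z} g hg => Nonempty.some ?_
  obtain ⟨Z⟩ := Z
  obtain ⟨g, rfl⟩ := t.toHeart.map_surjective g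
  rw [← Functor.map_comp, toHeart_map_eq_zero_iff] at hg
  obtain ⟨l, hl⟩ := h.exists_lift_comp hb Z.property.2 g.hom hg
  exact ⟨⟨t.toHeart.map (ObjectProperty.homMk l), by
    rw [← Functor.map_comp]
    exact congrArg t.toHeart.map (ObjectProperty.hom_ext _ hl)⟩⟩

lemma H_biprod {X Y : C} (hX : t.H X) (hY : t.H Y) : t.H (X ⊞ Y) := by
  obtain ⟨⟨V, W, i, d, hV, hW, _, e⟩, ⟨W', S, j, p, hW', hS, _, e'⟩⟩ := hX
  obtain ⟨⟨V₁, W₁, i₁, d₁, hV₁, hW₁, _, e₁⟩, ⟨W₁', S₁, j₁, p₁, hW₁', hS₁, _, e₁'⟩⟩ := hY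
  exact ⟨⟨V ⊞ V₁, W ⊞ W₁, _, _, t.cotorsion_UV.right.sum hV hV₁, t.W_biprod hW hW₁,
    _, E.conf_biprod e e₁⟩, ⟨W' ⊞ W₁', S ⊞ S₁, _, _, t.W_biprod hW' hW₁',
    t.cotorsion_ST.left.sum hS hS₁, _, E.conf_biprod e' e₁'⟩⟩

lemma H_of_isZero {X : C} (hX : IsZero X) : t.H X := by
  obtain ⟨A, i, w, h⟩ := E.id_deflation X
  obtain ⟨Z, d, w', h'⟩ := E.id_inflation X
  have e : E.IsShortExact i (𝟙 X) := ⟨w, h⟩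
  have e' : E.IsShortExact (𝟙 X) d := ⟨w', h'⟩
  -- The complementary terms of identity conflations embed in, or are quotients of, the zero object
  -- `X`.
  have hA : IsZero A := by
    have := e.mono
    exact hX.of_mono i
  have hZ : IsZero Z := by
    have := e'.epi
    exact hX.of_epi d
  exact ⟨⟨A, X, i, 𝟙 X, t.cotorsion_UV.right.of_isZero hA, t.W_of_isZero hX, e⟩,
    ⟨X, Z, 𝟙 X, d, t.W_of_isZero hX, t.cotorsion_ST.left.of_isZero hZ, e'⟩⟩

instance : HasFiniteBiproducts t.Heart := by
  have : HasZeroObject t.Heart := by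
    let Z : t.H.FullSubcategory := ⟨0, H_of_isZero (isZero_zero C)⟩
    refine ⟨t.toHeart.obj Z, ?_⟩
    rw [IsZero.iff_id_eq_zero, ← t.toHeart.map_id, toHeart_map_eq_zero_iff]
    exact ⟨0, t.W_of_isZero (isZero_zero C), 0, 0, (isZero_zero C).eq_of_src _ _⟩
  have : HasBinaryBiproducts t.Heart := by
    refine ⟨?_⟩
    rintro ⟨X⟩ ⟨Y⟩
    let P : t.H.FullSubcategory := ⟨X.obj ⊞ Y.obj, H_biprod X.property Y.property⟩
    let c : BinaryBicone X Y :=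
      { pt := P
        fst := ObjectProperty.homMk biprod.fst
        snd := ObjectProperty.homMk biprod.snd
        inl := ObjectProperty.homMk biprod.inl
        inr := ObjectProperty.homMk biprod.inr
        inl_fst := ObjectProperty.hom_ext _ biprod.inl_fst
        inl_snd := ObjectProperty.hom_ext _ biprod.inl_snd
        inr_fst := ObjectProperty.hom_ext _ biprod.inr_fst
        inr_snd := ObjectProperty.hom_ext _ biprod.inr_snd }
    refine HasBinaryBiproduct.mk ⟨t.toHeart.mapBinaryBicone c,
      isBinaryBilimitOfTotal _ ?_⟩
    -- In a preadditive category this identity makes a bicone a biproduct, and the additive quotient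
    -- functor preserves it.
    have h : c.fst ≫ c.inl + c.snd ≫ c.inr = 𝟙 P := ObjectProperty.hom_ext _ biprod.total
    exact congrArg t.toHeart.map h
  have := hasFiniteProducts_of_has_binary_and_terminal (C := t.Heart)
  exact HasFiniteBiproducts.of_hasFiniteProducts

end Heart

end TwinCotorsionPair

end TwinCotorsion
theorem theorem3 {B : Type u} [Category.{v} B] [Preadditive B] [HasFiniteBiproducts B]
    (hKS : TwinCotorsion.IsKrullSchmidt B)
    (E : TwinCotorsion.ExactStructure B)
    (hP : E.HasEnoughProjectives) (hI : E.HasEnoughInjectives)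
    (t : TwinCotorsion.TwinCotorsionPair E) :
    TwinCotorsion.IsPreabelian t.Heart ∧
    (∀ {X Y : t.H.FullSubcategory} (f : X ⟶ Y),
      (∃ (Cf Cf' : B) (c : Y.obj ⟶ Cf) (b : Cf ⟶ Cf'), t.IsCone f.hom c ∧ t.IsPlus b) ∧
      ∀ {Cf Cf' : B} (c : Y.obj ⟶ Cf) (b : Cf ⟶ Cf'), t.IsCone f.hom c → t.IsPlus b →
        ∃ (hC : t.H Cf')
          (w : t.toHeart.map f ≫
            t.toHeart.map (ObjectProperty.homMk (c ≫ b) : Y ⟶ ⟨Cf', hC⟩) = 0),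
          Nonempty (IsColimit (CokernelCofork.ofπ
            (t.toHeart.map (ObjectProperty.homMk (c ≫ b) : Y ⟶ ⟨Cf', hC⟩)) w))) ∧
    (∀ {X Y : t.H.FullSubcategory} (f : X ⟶ Y),
      (∃ (Kf Kf' : B) (k : Kf ⟶ X.obj) (b : Kf' ⟶ Kf), t.IsCocone f.hom k ∧ t.IsMinus b) ∧
      ∀ {Kf Kf' : B} (k : Kf ⟶ X.obj) (b : Kf' ⟶ Kf), t.IsCocone f.hom k → t.IsMinus b →
        ∃ (hK : t.H Kf')
          (w : t.toHeart.map (ObjectProperty.homMk (b ≫ k) : (⟨Kf', hK⟩ : t.H.FullSubcategory) ⟶ X) ≫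
            t.toHeart.map f = 0),
          Nonempty (IsLimit (KernelFork.ofι
            (t.toHeart.map (ObjectProperty.homMk (b ≫ k) : (⟨Kf', hK⟩ : t.H.FullSubcategory) ⟶ X))
            w))) := by
  refine ⟨⟨inferInstance, ⟨?_⟩, ⟨?_⟩⟩, fun {X Y} f => ⟨?_, fun {Q Q'} c b hc hb => ?_⟩,
    fun {X Y} f => ⟨?_, fun {K K'} k b hk hb => ?_⟩⟩
  · rintro ⟨X⟩ ⟨Y⟩ f
    obtain ⟨f, rfl⟩ := t.toHeart.map_surjective f
    obtain ⟨K, k, hk⟩ := Y.property.1.exists_isCocone f.hom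
    obtain ⟨K', b, hb⟩ := t.exists_isMinus K
    -- Membership in `H`: `B⁺` passes from `X` to `K` and on to `K'`, whereas `B⁻` holds for `K'` by
    -- its construction.
    obtain ⟨w, ⟨hl⟩⟩ := hk.nonempty_isLimit
      (Q := ⟨K', hb.bplus hP (hk.bplus hP X.property.1), hb.bminus hP⟩) hb
    exact ⟨_, hl⟩
  · rintro ⟨X⟩ ⟨Y⟩ f
    obtain ⟨f, rfl⟩ := t.toHeart.map_surjective f
    obtain ⟨Q, c, hc⟩ := X.property.2.exists_isCone f.hom
    obtain ⟨Q', b, hb⟩ := t.exists_isPlus Q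
    obtain ⟨w, ⟨hl⟩⟩ := hc.nonempty_isColimit
      (Q := ⟨Q', hb.bplus hI, hb.bminus hI (hc.bminus hI Y.property.2)⟩) hb
    exact ⟨_, hl⟩
  · obtain ⟨Q, c, hc⟩ := X.property.2.exists_isCone f.hom
    obtain ⟨Q', b, hb⟩ := t.exists_isPlus Q
    exact ⟨Q, Q', c, b, hc, hb⟩
  · exact ⟨⟨hb.bplus hI, hb.bminus hI (hc.bminus hI Y.property.2)⟩, hc.nonempty_isColimit hb⟩
  · obtain ⟨K, k, hk⟩ := Y.property.1.exists_isCocone f.hom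
    obtain ⟨K', b, hb⟩ := t.exists_isMinus K
    exact ⟨K, K', k, b, hk, hb⟩
  · exact ⟨⟨hb.bplus hP (hk.bplus hP X.property.1), hb.bminus hP⟩, hk.nonempty_isLimit hb⟩
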